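/- Let $p\ge 2$ be an integer. Let $G$ be the Vilenkin group of all sequences $x=(x_j)_{j\in\mathbb Z}$, $x_j\in\{0,\dots,p-1\}$, with only finitely many nonzero $x_j$ with $j<0$, under coordinatewise addition $\oplus$ modulo $p$ (inverse operation $\ominus$, zero element $\theta$), with the group topology in which the subgroups $U_l=\{x: x_j=0 \text{ for } j\le l\}$, $l\in\mathbb Z$, are a basis of neighbourhoods of $\theta$, and with the Haar measure $\mu$ normalized by $\mu(U_0)=1$. Let $A$ be the automorphism $(Ax)_j=x_{j+1}$ and let $\chi(x,\omega)=\exp\bigl(\frac{2\pi i}{p}\sum_{j\in\mathbb Z}x_j\omega_{1-j}\bigr)$. For an integer $\alpha\ge 0$ let $h_{[\alpha]}\in G$ be the element whose coordinate of index $-i$ is the $i$-th base-$p$ digit of $\alpha$ ($i\ge0$) and whose coordinates of positive index are $0$; put $W_\alpha(x)=\chi(x,h_{[\alpha]})$ and $\delta_l=A^{-1}h_{[l]}$ for $0\le l\le p-1$. A Walsh polynomial is a finite complex linear combination of the functions $W_\alpha$. The Fourier transform is $\widehat f(\omega)=\int_G f(x)\overline{\chi(x,\omega)}\,d\mu(x)$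 for $f\in L^1(G)$, extended by continuity from $L^1(G)\cap L^2(G)$ to $L^2(G)$. **Theorem.** Let $m_0$ be a Walsh polynomial such that $m_0(\theta)=1$ and $$\sum_{l=0}^{p-1}|m_0(\omega\oplus\delta_l)|^2\le 1\qquad\text{for all }\omega\in G.$$ Then the infinite product $$g(\omega)=\prod_{j=1}^\infty m_0(A^{-j}\omega)$$ converges for every $\omega\in G$, and $g\in L^2(G)$. There is a function $\varphi\in L^2(G)$, unique up to equality almost everywhere, with $\widehat\varphi=g$. It is compactly supported (it vanishes almost everywhere outside some compact set), and it is refinable with mask $m_0$: there are an integer $n\ge1$ and complex numbers $a_0,\dots,a_{p^n-1}$ such that $$\varphi(x)=p\sum_{\alpha=0}^{p^n-1}a_\alpha\,\varphi(Ax\ominus h_{[\alpha]})\ \text{ for almost every } x\in G,\qquad m_0(\omega)=\sum_{\alpha=0}^{p^n-1}a_\alpha\overline{W_\alpha(\omega)}\ \text{ for all }\omega\in G.$$ -/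

import Mathlib

/-- The sequences `x : ℤ → {0, …, p - 1}` (digits in `ZMod p`) with at most finitely many nonzero
coordinates of negative index; the operation is coordinatewise addition modulo `p`. -/
def vilenkinSubgroup (p : ℕ) : AddSubgroup (ℤ → ZMod p) where
  carrier := {x | {j : ℤ | j < 0 ∧ x j ≠ 0}.Finite}
  zero_mem' := by simp
  add_mem' := by
    intro x y hx hy
    refine (Set.Finite.union hx hy).subset ?_
    rintro j ⟨hj, hxy⟩
    by_cases h : x j = 0
    · exact Or.inr ⟨hj, fun h' => hxy (by simp [h, h'])⟩
    · exact Or.inl ⟨hj, h⟩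
  neg_mem' := by
    intro x hx
    refine Set.Finite.subset hx ?_
    rintro j ⟨hj, h⟩
    exact ⟨hj, by simpa using h⟩

/-- The Vilenkin group `G = G_p`. It is a separate type, so that it does not inherit the product
topology from `ℤ → ZMod p`. -/
def VilenkinGroup (p : ℕ) : Type := vilenkinSubgroup p

namespace VilenkinGroup

instance (p : ℕ) : AddCommGroup (VilenkinGroup p) :=
  inferInstanceAs (AddCommGroup (vilenkinSubgroup p))

/-- The coordinate `x_j` of `x ∈ G`. -/
def coord {p : ℕ} (x : VilenkinGroup p) (j : ℤ) : ZMod p := x.1 j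

theorem ext_coord {p : ℕ} {x y : VilenkinGroup p} (h : ∀ j, x.coord j = y.coord j) : x = y :=
  Subtype.ext (funext h)

theorem coord_zero {p : ℕ} (j : ℤ) : (0 : VilenkinGroup p).coord j = 0 := rfl

theorem coord_add {p : ℕ} (x y : VilenkinGroup p) (j : ℤ) :
    (x + y).coord j = x.coord j + y.coord j := rfl

theorem coord_neg {p : ℕ} (x : VilenkinGroup p) (j : ℤ) : (-x).coord j = -x.coord j := rfl

/-- The basic neighbourhoods of zero `U_l = {x | x_j = 0 for j ≤ l}`. -/
def U (p : ℕ) (l : ℤ) : AddSubgroup (VilenkinGroup p) where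
  carrier := {x | ∀ j ≤ l, x.coord j = 0}
  zero_mem' := fun _ _ => rfl
  add_mem' := by
    intro x y hx hy j hj
    rw [coord_add, hx j hj, hy j hj, add_zero]
  neg_mem' := by
    intro x hx j hj
    rw [coord_neg, hx j hj, neg_zero]

/-- The sets `U_l`, as a basis of neighbourhoods of zero for a group topology. -/
@[reducible] def filterBasis (p : ℕ) : AddGroupFilterBasis (VilenkinGroup p) where
  sets := {V | ∃ l : ℤ, V = (U p l : Set (VilenkinGroup p))}
  nonempty := ⟨_, 0, rfl⟩
  inter_sets := by
    rintro _ _ ⟨k, rfl⟩ ⟨l, rfl⟩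
    exact ⟨_, ⟨max k l, rfl⟩, fun x hx =>
      ⟨fun j hj => hx j (le_max_of_le_left hj), fun j hj => hx j (le_max_of_le_right hj)⟩⟩
  zero' := by
    rintro _ ⟨l, rfl⟩
    exact (U p l).zero_mem
  add' := by
    rintro _ ⟨l, rfl⟩
    refine ⟨_, ⟨l, rfl⟩, ?_⟩
    rintro _ ⟨x, hx, y, hy, rfl⟩
    exact (U p l).add_mem hx hy
  neg' := by
    rintro _ ⟨l, rfl⟩
    exact ⟨_, ⟨l, rfl⟩, fun x hx => (U p l).neg_mem hx⟩
  conj' := by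
    rintro x _ ⟨l, rfl⟩
    exact ⟨_, ⟨l, rfl⟩, fun y hy => by simpa using hy⟩

/-- The topology of `G`: the sets `U_l` are a basis of neighbourhoods of zero. -/
instance (p : ℕ) : TopologicalSpace (VilenkinGroup p) := (filterBasis p).topology

instance (p : ℕ) : IsTopologicalAddGroup (VilenkinGroup p) :=
  (filterBasis p).isTopologicalAddGroup

instance (p : ℕ) : MeasurableSpace (VilenkinGroup p) := borel _

instance (p : ℕ) : BorelSpace (VilenkinGroup p) := ⟨rfl⟩

theorem U_mem_nhds (p : ℕ) (l : ℤ) :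
    (U p l : Set (VilenkinGroup p)) ∈ nhds (0 : VilenkinGroup p) :=
  (filterBasis p).mem_nhds_zero ⟨l, rfl⟩

/-- The element of `U = U_0` with coordinates `x_{i+1} = t i`, `i = 0, 1, 2, …`. -/
def ofDigits {p : ℕ} (t : ℕ → ZMod p) : VilenkinGroup p :=
  ⟨fun j => if 0 < j then t (j - 1).toNat else 0, by
    refine Set.Finite.subset Set.finite_empty ?_
    rintro j ⟨hj, h⟩
    exact h (if_neg (by omega))⟩

theorem coord_ofDigits {p : ℕ} (t : ℕ → ZMod p) (j : ℤ) :
    (ofDigits t).coord j = if 0 < j then t (j - 1).toNat else 0 := rfl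

theorem range_ofDigits (p : ℕ) :
    Set.range (ofDigits : (ℕ → ZMod p) → VilenkinGroup p) = U p 0 := by
  ext x
  constructor
  · rintro ⟨t, rfl⟩ j hj
    rw [coord_ofDigits, if_neg (by omega)]
  · intro hx
    refine ⟨fun i => x.coord (i + 1), ext_coord fun j => ?_⟩
    rw [coord_ofDigits]
    split_ifs with h
    · congr 1
      omega
    · exact (hx j (by omega)).symm

theorem isCompact_U (p : ℕ) [NeZero p] : IsCompact (U p 0 : Set (VilenkinGroup p)) := by
  let _ : TopologicalSpace (ZMod p) := ⊥
  have : DiscreteTopology (ZMod p) := ⟨rfl⟩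
  have : CompactSpace (ZMod p) := Finite.compactSpace
  rw [← range_ofDigits]
  refine isCompact_range (continuous_iff_continuousAt.2 fun t => ?_)
  refine ((filterBasis p).nhds_hasBasis (ofDigits t)).tendsto_right_iff.2 ?_
  rintro _ ⟨l, rfl⟩
  have hev : ∀ᶠ s in nhds t, ∀ i ∈ Finset.range l.toNat, s i = t i := by
    refine (Finset.eventually_all _).2 fun i _ => ?_
    exact (continuous_apply i).continuousAt.eventually
      (show ∀ᶠ y in nhds (t i), y = t i by simp [nhds_discrete])
  filter_upwards [hev] with s hs
  refine ⟨ofDigits s - ofDigits t, fun j hj => ?_, by simp⟩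
  rw [sub_eq_add_neg, coord_add, coord_neg, coord_ofDigits, coord_ofDigits]
  split_ifs with h
  · rw [hs _ (by rw [Finset.mem_range]; omega), add_neg_cancel]
  · simp

/-- The Haar measure `μ` of `G`, normalized by `μ(U) = 1`. -/
noncomputable def haar (p : ℕ) [NeZero p] : MeasureTheory.Measure (VilenkinGroup p) :=
  MeasureTheory.Measure.addHaarMeasure
    ⟨⟨U p 0, isCompact_U p⟩, ⟨0, mem_interior_iff_mem_nhds.2 (U_mem_nhds p 0)⟩⟩

theorem haar_U (p : ℕ) [NeZero p] : haar p (U p 0 : Set (VilenkinGroup p)) = 1 :=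
  MeasureTheory.Measure.addHaarMeasure_self

theorem finite_shift {p : ℕ} (x : VilenkinGroup p) (k : ℤ) :
    {j : ℤ | j < 0 ∧ x.coord (j + k) ≠ 0}.Finite := by
  have h1 : {i : ℤ | i < 0 ∧ x.coord i ≠ 0}.Finite := x.2
  have h2 : ((fun i : ℤ => i - k) ''
      ({i : ℤ | i < 0 ∧ x.coord i ≠ 0} ∪ Set.Ico 0 k)).Finite :=
    (h1.union (Set.finite_Ico 0 k)).image _
  refine h2.subset ?_
  rintro j ⟨hj, hx⟩
  refine ⟨j + k, ?_, by simp⟩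
  by_cases h : j + k < 0
  · exact Or.inl ⟨h, hx⟩
  · exact Or.inr ⟨by omega, by omega⟩

/-- The automorphism `A` of `G`, `(A x)_j = x_{j+1}`. -/
def A (p : ℕ) : VilenkinGroup p ≃+ VilenkinGroup p where
  toFun x := ⟨fun j => x.coord (j + 1), finite_shift x 1⟩
  invFun x := ⟨fun j => x.coord (j - 1), finite_shift x (-1)⟩
  left_inv x := ext_coord fun j => congrArg x.coord (sub_add_cancel j 1)
  right_inv x := ext_coord fun j => congrArg x.coord (add_sub_cancel_right j 1)
  map_add' _ _ := rfl

/-- The element `h_[α]` of `H = {x | x_j = 0 for j > 0}` with `∑_j x_j p^(-j) = α`: the coordinate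
of index `-i` is the `i`-th digit of `α` in base `p`. -/
def h (p α : ℕ) : VilenkinGroup p :=
  ⟨fun j => if j ≤ 0 then ((α / p ^ (-j).toNat : ℕ) : ZMod p) else 0, by
    by_cases hp : 2 ≤ p
    · refine (Set.finite_Icc (-(α : ℤ)) 0).subset ?_
      rintro j ⟨hj, hne⟩
      refine ⟨?_, hj.le⟩
      by_contra hlt
      refine hne ?_
      have hα : α < p ^ (-j).toNat :=
        lt_of_lt_of_le (Nat.lt_pow_self (by omega : 1 < p))
          (Nat.pow_le_pow_right (by omega) (by omega))
      simp [Nat.div_eq_of_lt hα]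
    · refine (Set.finite_empty).subset ?_
      rintro j ⟨hj, hne⟩
      refine hne ?_
      interval_cases p
      · have : (-j).toNat ≠ 0 := by omega
        simp [zero_pow this]
      · exact Subsingleton.elim _ _⟩

/-- The elements `δ_l = A⁻¹ h_[l]`, `0 ≤ l < p`: the coordinate of index `1` is `l` and the others
vanish. -/
def delta (p l : ℕ) : VilenkinGroup p := (A p).symm (h p l)

/-- The characters `χ(x, ω) = exp ((2πi/p) ∑_j x_j ω_{1-j})`; only finitely many terms of the sum
are nonzero. -/
noncomputable def chi {p : ℕ} (x ω : VilenkinGroup p) : ℂ :=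
  Complex.exp (2 * Real.pi * Complex.I / p *
    ((∑ᶠ j : ℤ, (x.coord j).val * (ω.coord (1 - j)).val : ℕ) : ℂ))

/-- The generalized Walsh functions `W_α(x) = χ(x, h_[α])`. -/
noncomputable def W (p α : ℕ) (x : VilenkinGroup p) : ℂ := chi x (h p α)

/-- Walsh polynomials: finite linear combinations of generalized Walsh functions. -/
def IsWalshPolynomial {p : ℕ} (m : VilenkinGroup p → ℂ) : Prop :=
  m ∈ Submodule.span ℂ (Set.range (W p))

/-- The infinite product `g(ω) = ∏_{j ≥ 1} m(A^{-j} ω)`. -/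
noncomputable def maskProduct {p : ℕ} (m : VilenkinGroup p → ℂ) (ω : VilenkinGroup p) : ℂ :=
  ∏' j : ℕ, m ((A p).symm^[j + 1] ω)

/-- The Fourier transform on `L¹(G)`. -/
noncomputable def fourierL1 {p : ℕ} [NeZero p] (f : VilenkinGroup p → ℂ)
    (ω : VilenkinGroup p) : ℂ :=
  ∫ x, f x * starRingEnd ℂ (chi x ω) ∂(haar p)

/-- `f̂ = F` in `L²(G)`, for the continuous extension of the Fourier transform from
`L¹(G) ∩ L²(G)` to `L²(G)`: some sequence in `L¹(G) ∩ L²(G)` converges to `f` in `L²(G)` while its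
Fourier transforms converge to `F` in `L²(G)`. -/
def IsFourierL2 {p : ℕ} [NeZero p] (f F : VilenkinGroup p → ℂ) : Prop :=
  MeasureTheory.MemLp f 2 (haar p) ∧ MeasureTheory.MemLp F 2 (haar p) ∧
  ∃ u : ℕ → VilenkinGroup p → ℂ,
    (∀ n, MeasureTheory.MemLp (u n) 1 (haar p) ∧ MeasureTheory.MemLp (u n) 2 (haar p)) ∧
    Filter.Tendsto (fun n => MeasureTheory.eLpNorm (u n - f) 2 (haar p)) Filter.atTop (nhds 0) ∧
    Filter.Tendsto (fun n => MeasureTheory.eLpNorm (fourierL1 (u n) - F) 2 (haar p))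
      Filter.atTop (nhds 0)

/-- A function, taken up to null sets, is compactly supported if it vanishes almost everywhere
outside some compact set. -/
def IsCompactlySupported {p : ℕ} [NeZero p] (f : VilenkinGroup p → ℂ) : Prop :=
  ∃ K : Set (VilenkinGroup p), IsCompact K ∧ ∀ᵐ x ∂(haar p), x ∉ K → f x = 0

/-- `φ ∈ L²(G)` is refinable, `φ(x) = p ∑_{α < p^n} a_α φ(A x ⊖ h_[α])` in `L²(G)`, and its mask
is `m(ω) = ∑_{α < p^n} a_α conj(W_α(ω))`. -/
def IsRefinableWithMask {p : ℕ} [NeZero p] (φ m : VilenkinGroup p → ℂ) : Prop :=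
  MeasureTheory.MemLp φ 2 (haar p) ∧
  ∃ n : ℕ, 1 ≤ n ∧ ∃ a : ℕ → ℂ,
    (∀ᵐ x ∂(haar p), φ x = p * ∑ α ∈ Finset.range (p ^ n), a α * φ (A p x - h p α)) ∧
    ∀ ω, m ω = ∑ α ∈ Finset.range (p ^ n), a α * starRingEnd ℂ (W p α ω)

end VilenkinGroup

namespace VilenkinGroup

open MeasureTheory Filter Topology

variable {p : ℕ}

/-! ### Coordinates and the pairing -/

/-! A Walsh polynomial `m` sees only the coordinates of index `1, …, n` for some `n`
(`dependsOnDigits_sum`). For `ω ∈ U_{-N}`, all but finitely many points `A^{-j} ω` vanish in these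
coordinates, so the product has finitely many factors other than `m 0 = 1`. It is constant on the
cosets of `U_{n-1}` and satisfies `g (A ω) = g ω * m ω` (`maskProduct_A`).

Square integrability: let `P_N` be the product of the first `N` factors `|m (A^{-j} ω)|²`. Passing
from `U_{-N}` to `U_{-N-1}` adds one free coordinate, seen only by the new factor of `P_{N+1}`.
Summing over it gives at most `1` by hypothesis, so the integral of `P_N` over `U_{-N}` never
exceeds `1` (`lintegral_normSqProd_le`). As `|g|² ≤ P_N` on `U_{-N}`, also `∫ |g|² ≤ 1`.

Fourier analysis is needed only on test functions, compactly supported and constant on the cosets of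
some `U_M`. Since `U_{-l}` is the annihilator of `U_l`, the transform exchanges support and period;
inversion and Plancherel follow by direct computation (`IsTest.fourierL1_fourierInv`,
`IsTest.eLpNorm_fourierInv`). The truncations of `g` to `U_{-N}` are test functions, so their
inverse transforms form a Cauchy sequence in `L²`, with limit `φ`. These transforms all live on
`U_{-(n-1)}` and satisfy an exact refinement identity linking `N + 1` to `N`; both properties pass
to `φ` along subsequences converging almost everywhere. Uniqueness is a duality argument
(`IsFourierL2.ae_eq`). -/

theorem mem_U {l : ℤ} {x : VilenkinGroup p} : x ∈ U p l ↔ ∀ j ≤ l, x.coord j = 0 := Iff.rfl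

theorem U_antitone : Antitone (U p) := fun _ _ hlm _ hx j hj => hx j (hj.trans hlm)

theorem coord_sub (x y : VilenkinGroup p) (j : ℤ) : (x - y).coord j = x.coord j - y.coord j := rfl

theorem coord_A (x : VilenkinGroup p) (j : ℤ) : (A p x).coord j = x.coord (j + 1) := rfl

theorem coord_A_symm (x : VilenkinGroup p) (j : ℤ) :
    ((A p).symm x).coord j = x.coord (j - 1) := rfl

theorem coord_A_symm_iterate (k : ℕ) (x : VilenkinGroup p) (j : ℤ) :
    ((A p).symm^[k] x).coord j = x.coord (j - k) := by
  induction k generalizing j with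
  | zero => simp
  | succ k ih =>
    rw [Function.iterate_succ_apply', coord_A_symm, ih]
    congr 1
    push_cast
    ring

theorem A_mem_U {l : ℤ} {x : VilenkinGroup p} : A p x ∈ U p l ↔ x ∈ U p (l + 1) := by
  constructor
  · intro hx j hj
    simpa [coord_A] using hx (j - 1) (by omega)
  · intro hx j hj
    exact hx (j + 1) (by omega)

theorem exists_nat_mem_U (x : VilenkinGroup p) : ∃ N : ℕ, ∀ M : ℕ, N ≤ M → x ∈ U p (-M) := by
  obtain ⟨b, hb⟩ := (show {j : ℤ | j < 0 ∧ x.coord j ≠ 0}.Finite from x.2).bddBelow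
  refine ⟨(-b).toNat + 1, fun M hM j hj => ?_⟩
  by_contra hne
  have := hb ⟨(by omega : j < 0), hne⟩
  omega

/-- The element whose coordinate of index `l` is `c` and whose other coordinates vanish. -/
def single (l : ℤ) (c : ZMod p) : VilenkinGroup p :=
  ⟨Pi.single l c, (Set.finite_singleton l).subset fun j hj => by
    by_contra hne
    exact hj.2 (Pi.single_eq_of_ne (M := fun _ => ZMod p) hne c)⟩

theorem coord_single (l : ℤ) (c : ZMod p) (j : ℤ) :
    (single l c).coord j = if j = l then c else 0 := Pi.single_apply l c j

theorem single_mem_U {l m : ℤ} (hlm : m < l) (c : ZMod p) : single l c ∈ U p m := by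
  intro j hj
  rw [coord_single, if_neg (by omega)]

/-- The pairing `∑_j x_j ω_{1-j}` behind the characters. -/
noncomputable def pairing (x ω : VilenkinGroup p) : ZMod p :=
  ∑ᶠ j : ℤ, x.coord j * ω.coord (1 - j)

theorem finite_coord_ne_zero (x ω : VilenkinGroup p) :
    {j : ℤ | x.coord j ≠ 0 ∧ ω.coord (1 - j) ≠ 0}.Finite := by
  have hx : {j : ℤ | j < 0 ∧ x.coord j ≠ 0}.Finite := x.2
  have hω : {j : ℤ | j < 0 ∧ ω.coord j ≠ 0}.Finite := ω.2
  refine ((hx.union (hω.image fun j => 1 - j)).union (Set.finite_Icc 0 1)).subset ?_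
  rintro j ⟨h1, h2⟩
  by_cases hj : j < 0
  · exact Or.inl (Or.inl ⟨hj, h1⟩)
  by_cases hj' : 1 < j
  · exact Or.inl (Or.inr ⟨1 - j, ⟨by omega, h2⟩, by simp⟩)
  · exact Or.inr ⟨by omega, by omega⟩

theorem finite_support_pairing (x ω : VilenkinGroup p) :
    (Function.support fun j : ℤ => x.coord j * ω.coord (1 - j)).Finite :=
  (finite_coord_ne_zero x ω).subset fun _ hj => ⟨left_ne_zero_of_mul hj, right_ne_zero_of_mul hj⟩

theorem pairing_comm (x ω : VilenkinGroup p) : pairing x ω = pairing ω x := by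
  unfold pairing
  rw [← finsum_comp_equiv (Equiv.subLeft (1 : ℤ))]
  refine finsum_congr fun j => ?_
  simp [mul_comm]

theorem pairing_add_left (x y ω : VilenkinGroup p) :
    pairing (x + y) ω = pairing x ω + pairing y ω := by
  unfold pairing
  rw [← finsum_add_distrib (finite_support_pairing x ω) (finite_support_pairing y ω)]
  exact finsum_congr fun j => by rw [coord_add, add_mul]

theorem pairing_zero_left (ω : VilenkinGroup p) : pairing 0 ω = 0 := by
  simp [pairing, coord_zero]

theorem pairing_A (x ω : VilenkinGroup p) : pairing (A p x) ω = pairing x (A p ω) := by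
  unfold pairing
  rw [← finsum_comp_equiv (Equiv.subRight (1 : ℤ))]
  refine finsum_congr fun j => ?_
  simp only [Equiv.subRight_apply, coord_A]
  congr 2 <;> ring

theorem pairing_single (x : VilenkinGroup p) (j : ℤ) (c : ZMod p) :
    pairing x (single (1 - j) c) = x.coord j * c := by
  unfold pairing
  rw [finsum_eq_single _ j]
  · rw [coord_single, if_pos rfl]
  · intro i hi
    rw [coord_single, if_neg (by omega), mul_zero]

theorem pairing_congr {x y : VilenkinGroup p} {ω : VilenkinGroup p}
    (hxy : ∀ j, ω.coord (1 - j) ≠ 0 → x.coord j = y.coord j) : pairing x ω = pairing y ω := by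
  refine finsum_congr fun j => ?_
  by_cases hj : ω.coord (1 - j) = 0
  · simp [hj]
  · rw [hxy j hj]

/-! ### The topology -/

theorem hasBasis_nhds_zero : (𝓝 (0 : VilenkinGroup p)).HasBasis (fun _ : ℕ => True)
    fun l => (U p l : Set (VilenkinGroup p)) := by
  refine (filterBasis p).nhds_zero_hasBasis.to_hasBasis ?_ ?_
  · rintro _ ⟨l, rfl⟩
    exact ⟨l.toNat, trivial, U_antitone (by omega)⟩
  · intro l _
    exact ⟨_, ⟨(l : ℤ), rfl⟩, subset_rfl⟩

theorem isOpen_U (l : ℤ) : IsOpen (U p l : Set (VilenkinGroup p)) :=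
  AddSubgroup.isOpen_of_mem_nhds _ (U_mem_nhds p l)

theorem isClosed_U (l : ℤ) : IsClosed (U p l : Set (VilenkinGroup p)) :=
  AddSubgroup.isClosed_of_isOpen _ (isOpen_U l)

theorem measurableSet_U (l : ℤ) : MeasurableSet (U p l : Set (VilenkinGroup p)) :=
  (isOpen_U l).measurableSet

theorem sub_single_mem_U {l : ℤ} {x : VilenkinGroup p} (hx : x ∈ U p l) (c : ZMod p) :
    x - single (l + 1) c ∈ U p (l + 1) ↔ x.coord (l + 1) = c := by
  constructor
  · intro h
    have := h (l + 1) le_rfl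
    rwa [coord_sub, coord_single, if_pos rfl, sub_eq_zero] at this
  · intro h j hj
    rw [coord_sub, coord_single]
    split_ifs with hjl
    · rw [hjl, h, sub_self]
    · rw [hx j (by omega), sub_zero]

theorem U_eq_iUnion (l : ℤ) : (U p l : Set (VilenkinGroup p)) =
    ⋃ c : ZMod p, (fun x => x - single (l + 1) c) ⁻¹' (U p (l + 1)) := by
  ext x
  simp only [Set.mem_iUnion, Set.mem_preimage, SetLike.mem_coe]
  constructor
  · exact fun hx => ⟨_, (sub_single_mem_U hx _).2 rfl⟩
  · rintro ⟨c, hc⟩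
    have := (U p l).add_mem (U_antitone (by omega : l ≤ l + 1) hc)
      (single_mem_U (by omega : l < l + 1) c)
    rwa [sub_add_cancel] at this

theorem iUnion_U : ⋃ N : ℕ, (U p (-N) : Set (VilenkinGroup p)) = Set.univ := by
  refine Set.eq_univ_of_forall fun x => ?_
  obtain ⟨N, hN⟩ := exists_nat_mem_U x
  exact Set.mem_iUnion.2 ⟨N, hN N le_rfl⟩

theorem eventually_sub_mem_U (x : VilenkinGroup p) (l : ℤ) : ∀ᶠ y in 𝓝 x, y - x ∈ U p l := by
  have hc : Tendsto (fun y => y - x) (𝓝 x) (𝓝 0) := by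
    simpa using (continuous_id.sub continuous_const).tendsto (f := fun y => y - x) x
  exact hc (U_mem_nhds p l)

theorem continuous_of_invariant {α : Type*} [TopologicalSpace α] {f : VilenkinGroup p → α} (l : ℤ)
    (hf : ∀ x, ∀ u ∈ U p l, f (x + u) = f x) : Continuous f := by
  refine continuous_iff_continuousAt.2 fun x => ?_
  have hev : ∀ᶠ y in 𝓝 x, f y = f x := by
    filter_upwards [eventually_sub_mem_U x l] with y hy
    rw [← hf x _ hy, add_sub_cancel]
  exact (continuousAt_const (y := f x)).congr (hev.mono fun y hy => hy.symm)

theorem continuous_A : Continuous (A p) := by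
  refine continuous_of_continuousAt_zero (A p) ?_
  unfold ContinuousAt
  rw [map_zero]
  refine (hasBasis_nhds_zero.tendsto_iff hasBasis_nhds_zero).2 fun l _ => ⟨l + 1, trivial, ?_⟩
  intro x hx
  exact A_mem_U.2 (by simpa using hx)

theorem continuous_A_symm : Continuous (A p).symm := by
  refine continuous_of_continuousAt_zero (A p).symm ?_
  unfold ContinuousAt
  rw [map_zero]
  refine (hasBasis_nhds_zero.tendsto_iff hasBasis_nhds_zero).2 fun l _ => ⟨l, trivial, ?_⟩
  intro x hx j hj
  exact hx (j - 1) (by omega)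

/-! ### Characters -/

variable [NeZero p]

/-- The exponential has period `p` in the integer sum, so only its class in `ZMod p` matters, and
there the pairing is biadditive. -/
theorem chi_eq_stdAddChar (x ω : VilenkinGroup p) : chi x ω = ZMod.stdAddChar (pairing x ω) := by
  have hfin : (Function.support fun j : ℤ => (x.coord j).val * (ω.coord (1 - j)).val).Finite :=
    (finite_coord_ne_zero x ω).subset fun j hj =>
      ⟨fun h0 => hj (by simp [h0]), fun h0 => hj (by simp [h0])⟩
  have hcast : pairing x ω =
      ((∑ᶠ j : ℤ, (x.coord j).val * (ω.coord (1 - j)).val : ℕ) : ZMod p) := by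
    have := (Nat.castAddMonoidHom (ZMod p)).map_finsum hfin
    simp only [Nat.coe_castAddMonoidHom] at this
    rw [this]
    exact finsum_congr fun j => by simp
  rw [hcast, ZMod.stdAddChar_apply, ZMod.toCircle_natCast, chi]
  congr 1
  ring

theorem chi_comm (x ω : VilenkinGroup p) : chi x ω = chi ω x := by
  rw [chi_eq_stdAddChar, chi_eq_stdAddChar, pairing_comm]

theorem chi_add_left (x y ω : VilenkinGroup p) : chi (x + y) ω = chi x ω * chi y ω := by
  simp only [chi_eq_stdAddChar, pairing_add_left, AddChar.map_add_eq_mul]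

theorem chi_add_right (x ω η : VilenkinGroup p) : chi x (ω + η) = chi x ω * chi x η := by
  rw [chi_comm, chi_add_left, chi_comm ω, chi_comm η]

theorem chi_zero_left (ω : VilenkinGroup p) : chi 0 ω = 1 := by
  rw [chi_eq_stdAddChar, pairing_zero_left, AddChar.map_zero_eq_one]

theorem norm_chi (x ω : VilenkinGroup p) : ‖chi x ω‖ = 1 := by
  rw [chi_eq_stdAddChar, ZMod.stdAddChar_apply, Circle.norm_coe]

theorem conj_chi (x ω : VilenkinGroup p) : starRingEnd ℂ (chi x ω) = chi (-x) ω := by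
  have h1 : chi x ω * chi (-x) ω = 1 := by rw [← chi_add_left, add_neg_cancel, chi_zero_left]
  have h2 : chi x ω * starRingEnd ℂ (chi x ω) = 1 := by
    rw [Complex.mul_conj, Complex.normSq_eq_norm_sq, norm_chi]
    simp
  exact mul_left_cancel₀ (left_ne_zero_of_mul_eq_one h1) (h2.trans h1.symm)

theorem conj_chi_right (x ω : VilenkinGroup p) : starRingEnd ℂ (chi x ω) = chi x (-ω) := by
  rw [chi_comm, conj_chi, chi_comm]

theorem chi_A (x ω : VilenkinGroup p) : chi (A p x) ω = chi x (A p ω) := by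
  rw [chi_eq_stdAddChar, chi_eq_stdAddChar, pairing_A]

theorem chi_congr_left {x y : VilenkinGroup p} {ω : VilenkinGroup p}
    (hxy : ∀ j, ω.coord (1 - j) ≠ 0 → x.coord j = y.coord j) : chi x ω = chi y ω := by
  rw [chi_eq_stdAddChar, chi_eq_stdAddChar, pairing_congr hxy]

/-- A nonzero term of the pairing would need `l < j` and `m < 1 - j`, impossible when `0 ≤ l + m`.
With `exists_chi_ne_one` this makes `U_{-l}` the annihilator of `U_l`. -/
theorem chi_eq_one {l m : ℤ} (hlm : 0 ≤ l + m) {x ω : VilenkinGroup p} (hx : x ∈ U p l)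
    (hω : ω ∈ U p m) : chi x ω = 1 := by
  rw [← chi_zero_left ω]
  refine chi_congr_left fun j hj => ?_
  have : ¬ 1 - j ≤ m := fun hjm => hj (hω _ hjm)
  rw [hx j (by omega), coord_zero]

theorem exists_chi_ne_one {l : ℤ} {x : VilenkinGroup p} (hx : x ∉ U p (-l)) :
    ∃ ω ∈ U p l, chi x ω ≠ 1 := by
  rw [mem_U] at hx
  push Not at hx
  obtain ⟨j, hj, hne⟩ := hx
  refine ⟨single (1 - j) 1, single_mem_U (by omega) 1, fun h1 => hne ?_⟩
  rw [chi_eq_stdAddChar, pairing_single, mul_one,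
    ← AddChar.map_zero_eq_one (ZMod.stdAddChar (N := p))] at h1
  exact ZMod.injective_stdAddChar h1

/-! ### Compactness and continuity of characters -/

/-- Going down, `U_{-k-1}` is a union of `p` translates of `U_{-k}`; going up, `U_l` is closed in
`U_0`. -/
theorem isCompact_U_int (l : ℤ) : IsCompact (U p l : Set (VilenkinGroup p)) := by
  have hneg : ∀ k : ℕ, IsCompact (U p (-k) : Set (VilenkinGroup p)) := by
    intro k
    induction k with
    | zero => simpa using isCompact_U p
    | succ k ih =>
      rw [U_eq_iUnion]
      refine isCompact_iUnion fun c => ?_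
      have : (-((k + 1 : ℕ) : ℤ)) + 1 = -k := by push_cast; ring
      rw [this]
      exact (Homeomorph.subRight (single (-(k : ℤ)) c)).isCompact_preimage.2 ih
  exact (hneg (-l).toNat).of_isClosed_subset (isClosed_U l) (U_antitone (by omega))

instance : SigmaCompactSpace (VilenkinGroup p) :=
  ⟨⟨fun N => U p (-N), fun _ => isCompact_U_int _, iUnion_U⟩⟩

/-- Ensures that continuous functions on the product, in particular the kernel `chi`, are measurable
there, as Fubini's theorem requires. -/
instance : SecondCountableTopology (VilenkinGroup p) := by
  have : (𝓝 (0 : VilenkinGroup p)).IsCountablyGenerated := hasBasis_nhds_zero.isCountablyGenerated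
  let _ : UniformSpace (VilenkinGroup p) := IsTopologicalAddGroup.rightUniformSpace _
  have : IsUniformAddGroup (VilenkinGroup p) := isUniformAddGroup_of_addCommGroup
  have : (uniformity (VilenkinGroup p)).IsCountablyGenerated :=
    IsUniformAddGroup.uniformity_countably_generated
  infer_instance

theorem continuous_chi : Continuous fun z : VilenkinGroup p × VilenkinGroup p => chi z.1 z.2 := by
  refine continuous_iff_continuousAt.2 fun z => ?_
  obtain ⟨N, hN⟩ := exists_nat_mem_U z.1
  obtain ⟨M, hM⟩ := exists_nat_mem_U z.2
  set K : ℕ := max N M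
  have hev : ∀ᶠ y in 𝓝 z, chi y.1 y.2 = chi z.1 z.2 := by
    have h1 := (continuous_fst (X := VilenkinGroup p) (Y := VilenkinGroup p)).continuousAt.eventually
      (eventually_sub_mem_U z.1 K)
    have h2 := (continuous_snd (X := VilenkinGroup p) (Y := VilenkinGroup p)).continuousAt.eventually
      (eventually_sub_mem_U z.2 K)
    filter_upwards [h1, h2] with y hy1 hy2
    rw [← add_sub_cancel z.1 y.1, ← add_sub_cancel z.2 y.2, chi_add_left, chi_add_right,
      chi_add_right, chi_eq_one (by omega) (hN K (le_max_left _ _)) hy2,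
      chi_eq_one (by omega) hy1 (hM K (le_max_right _ _)), chi_eq_one (by omega) hy1 hy2]
    simp
  exact (continuousAt_const (y := chi z.1 z.2)).congr (hev.mono fun y hy => hy.symm)

theorem continuous_chi_left (ω : VilenkinGroup p) : Continuous fun x => chi x ω := by
  obtain ⟨N, hN⟩ := exists_nat_mem_U ω
  refine continuous_of_invariant N fun x u hu => ?_
  rw [chi_add_left, chi_eq_one (by omega) hu (hN N le_rfl), mul_one]

theorem continuous_chi_right (x : VilenkinGroup p) : Continuous fun ω => chi x ω := by
  simpa only [chi_comm x] using continuous_chi_left x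

/-! ### Haar measure -/

instance : (haar p).IsAddHaarMeasure := by
  unfold haar
  infer_instance

instance : LocallyCompactSpace (VilenkinGroup p) :=
  (isCompact_U p).locallyCompactSpace_of_mem_nhds_of_addGroup (U_mem_nhds p 0)

omit [NeZero p] in
theorem measurableSet_sub_single (l : ℤ) (c : ZMod p) :
    MeasurableSet ((fun x => x - single (l + 1) c) ⁻¹' (U p (l + 1) : Set (VilenkinGroup p))) :=
  (measurable_sub_const _) (measurableSet_U _)

theorem setLIntegral_U (l : ℤ) (F : VilenkinGroup p → ENNReal) :
    ∫⁻ x in U p l, F x ∂haar p =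
      ∑ c : ZMod p, ∫⁻ x in U p (l + 1), F (x + single (l + 1) c) ∂haar p := by
  rw [U_eq_iUnion l, lintegral_iUnion (measurableSet_sub_single l), tsum_fintype]
  · refine Finset.sum_congr rfl fun c _ => ?_
    have hmp : MeasurePreserving (fun x : VilenkinGroup p => x - single (l + 1) c)
        (haar p) (haar p) := measurePreserving_sub_right _ _
    simpa only [sub_add_cancel] using hmp.setLIntegral_comp_preimage_emb
      (MeasurableEquiv.subRight _).measurableEmbedding (fun x => F (x + single (l + 1) c))
      (U p (l + 1))
  · intro c d hcd
    refine Set.disjoint_left.2 fun x hc hd => hcd ?_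
    have hx : x ∈ U p l := by
      rw [← SetLike.mem_coe, U_eq_iUnion]
      exact Set.mem_iUnion.2 ⟨c, hc⟩
    exact ((sub_single_mem_U hx c).1 hc).symm.trans ((sub_single_mem_U hx d).1 hd)

theorem haar_U_succ (l : ℤ) : haar p (U p l) = p * haar p (U p (l + 1)) := by
  simpa [ZMod.card] using setLIntegral_U (p := p) l fun _ => 1

theorem measureReal_U (l : ℤ) : (haar p).real (U p l) = (p : ℝ) ^ (-l) := by
  have hp : (p : ℝ) ≠ 0 := Nat.cast_ne_zero.2 (NeZero.ne p)
  have hstep : ∀ l : ℤ, (haar p).real (U p l) = p * (haar p).real (U p (l + 1)) := by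
    intro l
    simp [measureReal_def, haar_U_succ l]
  induction l using Int.induction_on with
  | zero => simp [measureReal_def, haar_U]
  | succ l ih =>
    refine mul_left_cancel₀ hp ?_
    rw [← hstep, ih, ← zpow_one_add₀ hp]
    congr 1
    ring
  | pred l ih =>
    rw [hstep, sub_add_cancel, ih, ← zpow_one_add₀ hp]
    congr 1
    ring

theorem measureReal_U_mul_neg (l : ℤ) :
    (haar p).real (U p l) * (haar p).real (U p (-l)) = 1 := by
  rw [measureReal_U, measureReal_U, ← zpow_add₀ (Nat.cast_ne_zero.2 (NeZero.ne p))]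
  simp

/-- The image is again a Haar measure, so it is determined by the mass it gives `U_0`, namely the
measure of `U_1`. -/
theorem map_A_haar : (haar p).map (A p) = (p : ENNReal)⁻¹ • haar p := by
  have hA : Measure.IsAddHaarMeasure ((haar p).map (A p)) :=
    (A p).isAddHaarMeasure_map (haar p) continuous_A continuous_A_symm
  have hU : (haar p).map (A p) (U p 0) = (p : ENNReal)⁻¹ := by
    rw [Measure.map_apply continuous_A.measurable (measurableSet_U 0)]
    have hpre : A p ⁻¹' (U p 0) = (U p 1 : Set (VilenkinGroup p)) := by
      ext x
      exact A_mem_U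
    rw [hpre]
    have h1 := haar_U_succ (p := p) 0
    rw [haar_U, zero_add] at h1
    exact ENNReal.eq_inv_of_mul_eq_one_left ((mul_comm _ _).trans h1.symm)
  rw [Measure.addHaarMeasure_unique ((haar p).map (A p))
    ⟨⟨U p 0, isCompact_U p⟩, ⟨0, mem_interior_iff_mem_nhds.2 (U_mem_nhds p 0)⟩⟩]
  exact congrArg (· • haar p) hU

omit [NeZero p] in
theorem measurableEmbedding_A : MeasurableEmbedding (A p) :=
  Topology.IsClosedEmbedding.measurableEmbedding
    (Homeomorph.mk (A p).toEquiv continuous_A continuous_A_symm).isClosedEmbedding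

theorem integral_comp_A (f : VilenkinGroup p → ℂ) :
    p * ∫ x, f (A p x) ∂haar p = ∫ x, f x ∂haar p := by
  rw [← measurableEmbedding_A.integral_map, map_A_haar, integral_smul_measure]
  have hp : (p : ℂ) ≠ 0 := Nat.cast_ne_zero.2 (NeZero.ne p)
  simp [hp]

/-! ### A function whose integrals over all cosets of the `U_l` vanish -/

/-- The cosets of the subgroups `U_l`, together with the empty set. -/
def cosets (p : ℕ) : Set (Set (VilenkinGroup p)) :=
  insert ∅ {s | ∃ (l : ℤ) (a : VilenkinGroup p), s = (fun x => a + x) ⁻¹' (U p l)}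

omit [NeZero p] in
-- Two cosets are nested or disjoint, so the cosets together with `∅` form a π-system.
theorem preimage_inter_preimage_mem_cosets {l m : ℤ} (hlm : l ≤ m) (a b : VilenkinGroup p) :
    ((fun x => a + x) ⁻¹' (U p l)) ∩ ((fun x => b + x) ⁻¹' (U p m)) ∈ cosets p := by
  by_cases hab : a - b ∈ U p l
  · refine Or.inr ⟨m, b, Set.inter_eq_right.2 fun x hx => ?_⟩
    have := (U p l).add_mem hab (U_antitone hlm hx)
    rwa [show a - b + (b + x) = a + x by abel] at this
  · refine Or.inl (Set.eq_empty_of_forall_notMem ?_)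
    rintro x ⟨hxa, hxb⟩
    have := (U p l).sub_mem hxa (U_antitone hlm hxb)
    rw [show a + x - (b + x) = a - b by abel] at this
    exact hab this

omit [NeZero p] in
theorem inter_mem_cosets {s t : Set (VilenkinGroup p)} (hs : s ∈ cosets p) (ht : t ∈ cosets p) :
    s ∩ t ∈ cosets p := by
  rcases hs with rfl | ⟨l, a, rfl⟩
  · exact Or.inl (Set.empty_inter t)
  rcases ht with rfl | ⟨m, b, rfl⟩
  · exact Or.inl (Set.inter_empty _)
  rcases le_total l m with hlm | hlm
  · exact preimage_inter_preimage_mem_cosets hlm a b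
  · rw [Set.inter_comm]
    exact preimage_inter_preimage_mem_cosets hlm b a

theorem borel_eq_generateFrom_cosets :
    borel (VilenkinGroup p) = MeasurableSpace.generateFrom (cosets p) := by
  refine TopologicalSpace.IsTopologicalBasis.borel_eq_generateFrom ?_
  refine TopologicalSpace.isTopologicalBasis_of_isOpen_of_nhds ?_ ?_
  · rintro _ (rfl | ⟨l, a, rfl⟩)
    · exact isOpen_empty
    · exact (isOpen_U l).preimage (continuous_const_add a)
  · intro a s ha hs
    have hn : (fun x => a + x) ⁻¹' s ∈ 𝓝 (0 : VilenkinGroup p) :=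
      (continuous_const_add a).continuousAt.preimage_mem_nhds
        (by rw [add_zero]; exact hs.mem_nhds ha)
    obtain ⟨l, -, hl⟩ := hasBasis_nhds_zero.mem_iff.1 hn
    refine ⟨_, Or.inr ⟨l, -a, rfl⟩, by simp, fun x hx => ?_⟩
    simpa using hl hx

theorem ae_eq_zero_of_setIntegral_cosets {w : VilenkinGroup p → ℂ}
    (hw : LocallyIntegrable w (haar p))
    (h0 : ∀ (l : ℤ) (a : VilenkinGroup p), ∫ x in (fun x => a + x) ⁻¹' (U p l), w x ∂haar p = 0) :
    w =ᵐ[haar p] 0 := by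
  have hcos : ∀ s ∈ cosets p, ∫ x in s, w x ∂haar p = 0 := by
    rintro _ (rfl | ⟨l, a, rfl⟩)
    · simp
    · exact h0 l a
  -- The function is only locally integrable, so the π-λ argument runs on each `U_{-N}`, itself a
  -- coset.
  have hN : ∀ N : ℕ, w =ᵐ[(haar p).restrict (U p (-N))] 0 := by
    intro N
    have hint : IntegrableOn w (U p (-N)) (haar p) := hw.integrableOn_isCompact (isCompact_U_int _)
    have hU : (U p (-N) : Set (VilenkinGroup p)) ∈ cosets p := Or.inr ⟨-N, 0, by simp⟩
    have hall : ∀ s, MeasurableSet s →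
        ∫ x in s, w x ∂((haar p).restrict (U p (-N))) = 0 := by
      refine MeasurableSpace.induction_on_inter
        (BorelSpace.measurable_eq.trans borel_eq_generateFrom_cosets)
        (fun s hs t ht _ => inter_mem_cosets hs ht) (by simp) ?_ ?_ ?_
      · intro t ht
        have hm : MeasurableSet t := by
          rw [BorelSpace.measurable_eq (α := VilenkinGroup p), borel_eq_generateFrom_cosets]
          exact .basic t ht
        rw [Measure.restrict_restrict hm]
        exact hcos _ (inter_mem_cosets ht hU)
      · intro t ht h
        rw [setIntegral_compl ht hint, h, sub_zero]
        exact hcos _ hU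
      · intro f hd hf h
        rw [integral_iUnion hf hd hint.integrableOn]
        simp [h]
    exact Integrable.ae_eq_zero_of_forall_setIntegral_eq_zero hint fun s hs _ => hall s hs
  have := (ae_restrict_iUnion_iff (μ := haar p) (fun N : ℕ => (U p (-N) : Set (VilenkinGroup p)))
    (fun x => w x = 0)).2 hN
  rwa [iUnion_U, Measure.restrict_univ] at this

/-! ### The Fourier transform and its inverse on integrable functions -/

/-- The inverse Fourier transform on `L¹(G)`. -/
noncomputable def fourierInv (f : VilenkinGroup p → ℂ) (x : VilenkinGroup p) : ℂ :=
  ∫ ω, f ω * chi x ω ∂(haar p)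

theorem fourierL1_eq_fourierInv_neg (f : VilenkinGroup p → ℂ) (ω : VilenkinGroup p) :
    fourierL1 f ω = fourierInv f (-ω) := by
  simp only [fourierL1, fourierInv, conj_chi_right]
  simp only [chi_comm]

theorem conj_fourierInv (f : VilenkinGroup p → ℂ) (x : VilenkinGroup p) :
    starRingEnd ℂ (fourierInv f x) = fourierL1 (fun ω => starRingEnd ℂ (f ω)) x := by
  rw [fourierInv, ← integral_conj, fourierL1]
  simp only [map_mul, chi_comm x]

theorem integrable_mul_chi {f : VilenkinGroup p → ℂ} (hf : Integrable f (haar p))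
    (x : VilenkinGroup p) : Integrable (fun ω => f ω * chi x ω) (haar p) :=
  hf.mul_bdd (c := 1) (continuous_chi_right x).aestronglyMeasurable
    (Eventually.of_forall fun ω => (norm_chi x ω).le)

theorem fourierInv_sub {f g : VilenkinGroup p → ℂ} (hf : Integrable f (haar p))
    (hg : Integrable g (haar p)) : fourierInv (f - g) = fourierInv f - fourierInv g := by
  ext x
  simp only [fourierInv, Pi.sub_apply, sub_mul]
  exact integral_sub (integrable_mul_chi hf x) (integrable_mul_chi hg x)

theorem fourierL1_sub {f g : VilenkinGroup p → ℂ} (hf : Integrable f (haar p))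
    (hg : Integrable g (haar p)) : fourierL1 (f - g) = fourierL1 f - fourierL1 g := by
  ext x
  simp only [Pi.sub_apply, fourierL1_eq_fourierInv_neg, fourierInv_sub hf hg]

/-- Fubini's theorem and the symmetry of `chi`: the group is its own dual, so the transform is its
own transpose. -/
theorem integral_mul_fourierInv {f s : VilenkinGroup p → ℂ} (hf : Integrable f (haar p))
    (hs : Integrable s (haar p)) :
    ∫ x, s x * fourierInv f x ∂haar p = ∫ ω, f ω * fourierInv s ω ∂haar p := by
  have hint : Integrable (Function.uncurry fun x ω => s x * f ω * chi x ω)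
      ((haar p).prod (haar p)) :=
    (hs.mul_prod hf).mul_bdd (c := 1) continuous_chi.aestronglyMeasurable
      (Eventually.of_forall fun z => (norm_chi z.1 z.2).le)
  have hswap := integral_integral_swap hint
  have h1 : ∀ x, s x * fourierInv f x = ∫ ω, s x * f ω * chi x ω ∂haar p := by
    intro x
    rw [fourierInv, ← integral_const_mul]
    simp only [mul_assoc]
  have h2 : ∀ ω, f ω * fourierInv s ω = ∫ x, s x * f ω * chi x ω ∂haar p := by
    intro ω
    rw [fourierInv, ← integral_const_mul]
    refine integral_congr_ae (Eventually.of_forall fun x => ?_)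
    simp only [chi_comm ω x]
    ring
  simp only [h1, h2, hswap]

/-- Translating the variable by a period `u` multiplies the integral by `chi x u`, and some period
gives a factor other than `1`. -/
theorem fourierInv_eq_zero {M : ℤ} {f : VilenkinGroup p → ℂ}
    (hf : ∀ ω, ∀ u ∈ U p M, f (ω + u) = f ω) {x : VilenkinGroup p} (hx : x ∉ U p (-M)) :
    fourierInv f x = 0 := by
  obtain ⟨u, hu, hne⟩ := exists_chi_ne_one hx
  have h1 : fourierInv f x = chi x u * fourierInv f x := by
    conv_lhs => rw [fourierInv, ← integral_add_right_eq_self _ u]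
    rw [fourierInv, ← integral_const_mul]
    refine integral_congr_ae (Eventually.of_forall fun ω => ?_)
    simp only [hf ω u hu, chi_add_right]
    ring
  have h2 : (1 - chi x u) * fourierInv f x = 0 := by linear_combination h1
  exact (mul_eq_zero.1 h2).resolve_left (sub_ne_zero.2 hne.symm)

/-! ### Test functions -/

/-- Test functions: they are supported in `U_N` and constant on the cosets of `U_M`. -/
structure IsTest (N M : ℤ) (f : VilenkinGroup p → ℂ) : Prop where
  supp : ∀ ω, ω ∉ U p N → f ω = 0
  inv : ∀ ω, ∀ u ∈ U p M, f (ω + u) = f ω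

namespace IsTest

variable {N M : ℤ} {f : VilenkinGroup p → ℂ}

omit [NeZero p] in
theorem continuous (hf : IsTest N M f) : Continuous f := continuous_of_invariant M hf.inv

theorem hasCompactSupport (hf : IsTest N M f) : HasCompactSupport f :=
  HasCompactSupport.of_support_subset_isCompact (isCompact_U_int N) fun ω hω => by
    by_contra hN
    exact hω (hf.supp ω hN)

theorem memLp (hf : IsTest N M f) (q : ENNReal) : MemLp f q (haar p) :=
  hf.continuous.memLp_of_hasCompactSupport hf.hasCompactSupport

theorem integrable (hf : IsTest N M f) : Integrable f (haar p) :=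
  memLp_one_iff_integrable.1 (hf.memLp 1)

theorem fourierInv (hf : IsTest N M f) : IsTest (-M) (-N) (fourierInv f) where
  supp _ hx := fourierInv_eq_zero hf.inv hx
  inv x u hu := by
    refine integral_congr_ae (Eventually.of_forall fun ω => ?_)
    by_cases hω : ω ∈ U p N
    · simp only [chi_add_left, chi_eq_one (by omega) hu hω, mul_one]
    · simp only [hf.supp ω hω, zero_mul]

omit [NeZero p] in
theorem conj (hf : IsTest N M f) : IsTest N M fun ω => starRingEnd ℂ (f ω) where
  supp ω hω := by simp [hf.supp ω hω]
  inv ω u hu := by simp [hf.inv ω u hu]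

end IsTest

theorem isTest_indicator_chi (l : ℤ) (a : VilenkinGroup p) :
    ∃ M, IsTest l M ((U p l : Set (VilenkinGroup p)).indicator (chi a)) := by
  obtain ⟨N, hN⟩ := exists_nat_mem_U a
  refine ⟨max l N, fun ω hω => Set.indicator_of_notMem hω _, fun ω u hu => ?_⟩
  have hul : u ∈ U p l := U_antitone (le_max_left _ _) hu
  have huN : u ∈ U p N := U_antitone (le_max_right _ _) hu
  by_cases hω : ω ∈ U p l
  · rw [Set.indicator_of_mem ((U p l).add_mem hω hul), Set.indicator_of_mem hω, chi_add_right,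
      chi_eq_one (by omega) (hN N le_rfl) huN, mul_one]
  · rw [Set.indicator_of_notMem hω, Set.indicator_of_notMem fun hc => hω ?_]
    exact ((U p l).add_mem_cancel_right hul).1 hc

/-- Indicators of cosets are thus transforms of test functions up to a constant. This serves both
pointwise inversion and uniqueness. -/
theorem fourierInv_indicator_chi (l : ℤ) (a x : VilenkinGroup p) :
    fourierInv ((U p l : Set (VilenkinGroup p)).indicator (chi a)) x =
      ((fun x => a + x) ⁻¹' (U p (-l) : Set (VilenkinGroup p))).indicator
        (fun _ => ((haar p).real (U p l) : ℂ)) x := by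
  have h1 : fourierInv ((U p l : Set (VilenkinGroup p)).indicator (chi a)) x =
      fourierInv ((U p l : Set (VilenkinGroup p)).indicator 1) (a + x) := by
    refine integral_congr_ae (Eventually.of_forall fun ω => ?_)
    by_cases hω : ω ∈ (U p l : Set (VilenkinGroup p))
    · simp [hω, chi_add_left]
    · simp [hω]
  rw [h1]
  by_cases hx : x ∈ (fun x => a + x) ⁻¹' (U p (-l) : Set (VilenkinGroup p))
  · rw [Set.indicator_of_mem hx]
    have h2 : fourierInv ((U p l : Set (VilenkinGroup p)).indicator 1) (a + x) =
        ∫ ω, (U p l : Set (VilenkinGroup p)).indicator (fun _ => (1 : ℂ)) ω ∂haar p := by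
      refine integral_congr_ae (Eventually.of_forall fun ω => ?_)
      by_cases hω : ω ∈ U p l
      · simp [Set.indicator, hω, chi_eq_one (by omega) hx hω]
      · simp [Set.indicator, hω]
    rw [h2, integral_indicator_const _ (measurableSet_U l)]
    simp
  · rw [Set.indicator_of_notMem hx]
    refine fourierInv_eq_zero (M := l) (fun ω u hu => ?_) hx
    have hiff : ω + u ∈ U p l ↔ ω ∈ U p l := (U p l).add_mem_cancel_right hu
    by_cases hω : ω ∈ U p l
    · rw [Set.indicator_of_mem (hiff.2 hω), Set.indicator_of_mem hω, Pi.one_apply, Pi.one_apply]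
    · rw [Set.indicator_of_notMem (mt hiff.1 hω), Set.indicator_of_notMem hω]

theorem IsTest.fourierL1_fourierInv {N M : ℤ} {f : VilenkinGroup p → ℂ} (hf : IsTest N M f) :
    fourierL1 (VilenkinGroup.fourierInv f) = f := by
  ext ω
  -- The inverse transform of `f` lives on `U_{-M}`, so cutting the character off there changes
  -- nothing. After transposition, the integral averages `f` over `ω + U_M`, where it is constant,
  -- and `μ(U_M) μ(U_{-M}) = 1`.
  obtain ⟨K, hs⟩ := isTest_indicator_chi (-M) (-ω)
  have h1 : fourierL1 (VilenkinGroup.fourierInv f) ω =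
      ∫ x, (U p (-M) : Set (VilenkinGroup p)).indicator (chi (-ω)) x *
        VilenkinGroup.fourierInv f x ∂haar p := by
    refine integral_congr_ae (Eventually.of_forall fun x => ?_)
    by_cases hx : x ∈ U p (-M)
    · simp only [Set.indicator, SetLike.mem_coe, hx, if_true]
      rw [chi_comm x, conj_chi, mul_comm]
    · simp [hf.fourierInv.supp x hx]
  rw [h1, integral_mul_fourierInv hf.integrable hs.integrable, ← integral_add_left_eq_self _ ω]
  have h2 : ∀ η, f (ω + η) * VilenkinGroup.fourierInv
      ((U p (-M) : Set (VilenkinGroup p)).indicator (chi (-ω))) (ω + η) =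
      (U p M : Set (VilenkinGroup p)).indicator
        (fun _ => f ω * ((haar p).real (U p (-M)) : ℂ)) η := by
    intro η
    rw [fourierInv_indicator_chi]
    by_cases hη : η ∈ U p M
    · simp [Set.indicator, hη, hf.inv ω η hη]
    · simp [Set.indicator, hη]
  simp only [h2]
  rw [integral_indicator_const _ (measurableSet_U M), Complex.real_smul]
  have h3 : ((haar p).real (U p M) : ℂ) * ((haar p).real (U p (-M)) : ℂ) = 1 := by
    exact_mod_cast measureReal_U_mul_neg M
  linear_combination f ω * h3

/-- Transpose one transform: the inverse transform of the conjugate of `fourierInv f` is the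
conjugate of `f`, by inversion. -/
theorem IsTest.eLpNorm_fourierInv {N M : ℤ} {f : VilenkinGroup p → ℂ} (hf : IsTest N M f) :
    eLpNorm (VilenkinGroup.fourierInv f) 2 (haar p) = eLpNorm f 2 (haar p) := by
  have h1 : ∫ x, starRingEnd ℂ (VilenkinGroup.fourierInv f x) * VilenkinGroup.fourierInv f x
      ∂haar p = ∫ ω, starRingEnd ℂ (f ω) * f ω ∂haar p := by
    rw [integral_mul_fourierInv hf.integrable hf.fourierInv.conj.integrable]
    refine integral_congr_ae (Eventually.of_forall fun ω => ?_)
    have := congrFun hf.fourierL1_fourierInv ω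
    have h2 := congrArg (starRingEnd ℂ)
      (conj_fourierInv (fun x => starRingEnd ℂ (VilenkinGroup.fourierInv f x)) ω)
    simp only [Complex.conj_conj, this] at h2
    simp only [h2]
    ring
  simp only [Complex.conj_mul'] at h1
  have h3 : ∫ x, ‖VilenkinGroup.fourierInv f x‖ ^ 2 ∂haar p = ∫ ω, ‖f ω‖ ^ 2 ∂haar p := by
    have := h1
    simp only [← Complex.ofReal_pow, integral_complex_ofReal] at this
    exact_mod_cast this
  rw [(hf.fourierInv.memLp 2).eLpNorm_eq_integral_rpow_norm (by simp) (by simp),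
    (hf.memLp 2).eLpNorm_eq_integral_rpow_norm (by simp) (by simp)]
  simp [h3]

/-! ### Uniqueness of the inverse transform -/

theorem tendsto_integral_mul_of_eLpNorm {u : ℕ → VilenkinGroup p → ℂ} {f s : VilenkinGroup p → ℂ}
    (hu : ∀ n, MemLp (u n) 2 (haar p)) (hf : MemLp f 2 (haar p)) (hs : MemLp s 2 (haar p))
    (hlim : Tendsto (fun n => eLpNorm (u n - f) 2 (haar p)) atTop (𝓝 0)) :
    Tendsto (fun n => ∫ x, s x * u n x ∂haar p) atTop (𝓝 (∫ x, s x * f x ∂haar p)) := by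
  have hint : ∀ n, Integrable (fun x => s x * u n x) (haar p) := fun n =>
    MemLp.integrable_mul (p := 2) (q := 2) hs (hu n)
  refine tendsto_integral_of_L1' (fun x => s x * f x) (hs.1.mul hf.1)
    (F := fun n x => s x * u n x) (Eventually.of_forall hint) ?_
  refine tendsto_of_tendsto_of_tendsto_of_le_of_le tendsto_const_nhds ?_ (fun _ => zero_le) ?_
    (h := fun n => eLpNorm s 2 (haar p) * eLpNorm (u n - f) 2 (haar p))
  · simpa using ENNReal.Tendsto.const_mul hlim (Or.inr hs.eLpNorm_ne_top)
  · intro n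
    have heq : ((fun x => s x * u n x) - fun x => s x * f x) = s • (u n - f) := by
      ext x
      simp [mul_sub]
    beta_reduce
    rw [heq]
    exact eLpNorm_smul_le_mul_eLpNorm ((hu n).1.sub hf.1) hs.1

theorem fourierInv_fourierL1_swap {f s : VilenkinGroup p → ℂ} (hf : Integrable f (haar p))
    (hs : Integrable s (haar p)) :
    ∫ x, fourierInv s x * f x ∂haar p = ∫ ω, s (-ω) * fourierL1 f ω ∂haar p := by
  rw [← integral_neg_eq_self fun ω => s (-ω) * fourierL1 f ω]
  simp only [neg_neg, fourierL1_eq_fourierInv_neg]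
  rw [integral_mul_fourierInv hf hs]
  simp only [mul_comm]

/-- The differences of the approximating sequences tend to `f - f'` while their transforms tend to
`0`. Pairing with transforms of cut-off characters shows that `f - f'` has zero integral over every
coset. -/
theorem IsFourierL2.ae_eq {f f' F : VilenkinGroup p → ℂ} (h : IsFourierL2 f F)
    (h' : IsFourierL2 f' F) : f =ᵐ[haar p] f' := by
  obtain ⟨hf, hF, u, hu, huf, huF⟩ := h
  obtain ⟨hf', -, v, hv, hvf, hvF⟩ := h'
  have hmeas : ∀ {w : VilenkinGroup p → ℂ}, Integrable w (haar p) →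
      AEStronglyMeasurable (fourierL1 w) (haar p) := by
    intro w hw
    refine (Continuous.aestronglyMeasurable ?_)
    refine continuous_of_dominated (bound := fun x => ‖w x‖) (fun ω => ?_) (fun ω => ?_) hw.norm ?_
    · simp only [conj_chi_right]
      exact hw.1.mul (continuous_chi_left _).aestronglyMeasurable
    · exact Eventually.of_forall fun x => by simp [norm_chi]
    · refine Eventually.of_forall fun x => continuous_const.mul ?_
      exact Complex.continuous_conj.comp (continuous_chi_right x)
  have hsub : ∀ {a b : ℕ → VilenkinGroup p → ℂ} {c d : VilenkinGroup p → ℂ},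
      (∀ n, AEStronglyMeasurable (a n) (haar p)) → (∀ n, AEStronglyMeasurable (b n) (haar p)) →
      AEStronglyMeasurable c (haar p) → AEStronglyMeasurable d (haar p) →
      Tendsto (fun n => eLpNorm (a n - c) 2 (haar p)) atTop (𝓝 0) →
      Tendsto (fun n => eLpNorm (b n - d) 2 (haar p)) atTop (𝓝 0) →
      Tendsto (fun n => eLpNorm (a n - b n - (c - d)) 2 (haar p)) atTop (𝓝 0) := by
    intro a b c d ha hb hc hd hac hbd
    refine tendsto_of_tendsto_of_tendsto_of_le_of_le tendsto_const_nhds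
      (by simpa using hac.add hbd) (fun _ => zero_le) fun n => ?_
    have := eLpNorm_sub_le (p := 2) ((ha n).sub hc) ((hb n).sub hd) (by norm_num)
    rwa [sub_sub_sub_comm] at this
  have hui := fun n => memLp_one_iff_integrable.1 (hu n).1
  have hvi := fun n => memLp_one_iff_integrable.1 (hv n).1
  have hw := hsub (fun n => (hu n).2.1) (fun n => (hv n).2.1) hf.1 hf'.1 huf hvf
  have hW := hsub (fun n => hmeas (hui n)) (fun n => hmeas (hvi n)) hF.1 hF.1 huF hvF
  rw [sub_self] at hW
  -- Plancherel is available only for test functions, so these differences of transforms are known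
  -- to be in `L²` only for large `n`, because their norms tend to `0`.
  have hfin : ∀ᶠ n in atTop, MemLp (fourierL1 (u n) - fourierL1 (v n)) 2 (haar p) := by
    filter_upwards [hW.eventually (gt_mem_nhds ENNReal.zero_lt_top)] with n hn
    exact ⟨(hmeas (hui n)).sub (hmeas (hvi n)), by simpa using hn⟩
  obtain ⟨n₀, hn₀⟩ := eventually_atTop.1 hfin
  have hd : MemLp (f - f') 2 (haar p) := hf.sub hf'
  have hzero : f - f' =ᵐ[haar p] 0 := by
    refine ae_eq_zero_of_setIntegral_cosets (hd.locallyIntegrable (by norm_num)) fun l a => ?_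
    obtain ⟨M, hs⟩ := isTest_indicator_chi (-l) a
    set s := (U p (-l) : Set (VilenkinGroup p)).indicator (chi a)
    have hs' : MemLp (fun ω => s (-ω)) 2 (haar p) :=
      (hs.memLp 2).comp_measurePreserving (Measure.measurePreserving_neg (haar p))
    have hlim1 := (tendsto_integral_mul_of_eLpNorm (fun n => (hu n).2.sub (hv n).2) hd
      (hs.fourierInv.memLp 2) hw).comp (tendsto_add_atTop_nat n₀)
    have hlim2 := tendsto_integral_mul_of_eLpNorm (fun n => hn₀ (n + n₀) (by omega))
      MemLp.zero hs' (hW.comp (tendsto_add_atTop_nat n₀))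
    have heq : ∀ n, ∫ x, fourierInv s x * (u n - v n) x ∂haar p =
        ∫ ω, s (-ω) * (fourierL1 (u n) - fourierL1 (v n)) ω ∂haar p := by
      intro n
      rw [fourierInv_fourierL1_swap ((hui n).sub (hvi n)) hs.integrable,
        fourierL1_sub (hui n) (hvi n)]
    have hlim := tendsto_nhds_unique hlim1 (hlim2.congr fun n => (heq _).symm)
    have hset : MeasurableSet ((fun x => a + x) ⁻¹' (U p l : Set (VilenkinGroup p))) :=
      measurable_const_add a (measurableSet_U l)
    have hint : ∫ x, fourierInv s x * (f - f') x ∂haar p = ((haar p).real (U p (-l)) : ℂ) *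
        ∫ x in (fun x => a + x) ⁻¹' (U p l), (f - f') x ∂haar p := by
      rw [← integral_indicator hset, ← integral_const_mul]
      refine integral_congr_ae (Eventually.of_forall fun x => ?_)
      simp only [s, fourierInv_indicator_chi, neg_neg]
      by_cases hx : x ∈ (fun x => a + x) ⁻¹' (U p l : Set (VilenkinGroup p))
      · simp only [Set.indicator_of_mem hx]
      · simp only [Set.indicator_of_notMem hx, zero_mul, mul_zero]
    rw [hint] at hlim
    refine (mul_eq_zero.1 (hlim.trans (by simp))).resolve_left ?_
    exact_mod_cast right_ne_zero_of_mul_eq_one (measureReal_U_mul_neg (p := p) l)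
  filter_upwards [hzero] with x hx
  exact sub_eq_zero.1 hx

/-! ### Walsh polynomials -/

omit [NeZero p] in
theorem coord_h (α : ℕ) (j : ℤ) :
    (h p α).coord j = if j ≤ 0 then ((α / p ^ (-j).toNat : ℕ) : ZMod p) else 0 := rfl

theorem exists_neg_digits (n α : ℕ) (hα : α < p ^ n) :
    ∃ β < p ^ n, ∀ i : ℕ, ((β / p ^ i : ℕ) : ZMod p) = -((α / p ^ i : ℕ) : ZMod p) := by
  induction n generalizing α with
  | zero =>
    have : α = 0 := by simpa using hα
    exact ⟨0, by simp, by simp [this]⟩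
  | succ n ih =>
    have hp : 0 < p := NeZero.pos p
    obtain ⟨β, hβ, hdig⟩ := ih (α / p) (by rwa [Nat.div_lt_iff_lt_mul hp, ← pow_succ])
    have hval := ZMod.val_lt (-(α : ZMod p))
    refine ⟨(-(α : ZMod p)).val + p * β, ?_, fun i => ?_⟩
    · rw [pow_succ]
      calc (-(α : ZMod p)).val + p * β < p + p * β := by omega
        _ = (β + 1) * p := by ring
        _ ≤ p ^ n * p := Nat.mul_le_mul_right p hβ
    · cases i with
      | zero => simp
      | succ i =>
        rw [pow_succ', ← Nat.div_div_eq_div_mul, ← Nat.div_div_eq_div_mul, ← hdig i,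
          Nat.add_mul_div_left _ _ hp, Nat.div_eq_of_lt hval, zero_add]

/-- Negating digits keeps their number below `n`, so conjugation permutes the `W_α` with `α < p ^
n`. This turns an expansion in `W_α` into one in the conjugates. -/
theorem exists_h_eq_neg (n α : ℕ) (hα : α < p ^ n) : ∃ β < p ^ n, h p β = -h p α := by
  obtain ⟨β, hβ, hdig⟩ := exists_neg_digits n α hα
  refine ⟨β, hβ, ext_coord fun j => ?_⟩
  rw [coord_neg, coord_h, coord_h]
  split_ifs
  · exact hdig _
  · simp

theorem conj_W {α β : ℕ} (hβ : h p β = -h p α) (ω : VilenkinGroup p) :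
    starRingEnd ℂ (W p β ω) = W p α ω := by
  rw [W, W, conj_chi_right, hβ, neg_neg]

theorem IsWalshPolynomial.exists_eq_sum (hp : 2 ≤ p) {m : VilenkinGroup p → ℂ}
    (hm : IsWalshPolynomial m) : ∃ n : ℕ, 1 ≤ n ∧ ∃ a : ℕ → ℂ,
      ∀ ω, m ω = ∑ α ∈ Finset.range (p ^ n), a α * starRingEnd ℂ (W p α ω) := by
  obtain ⟨c, rfl⟩ := Finsupp.mem_span_range_iff_exists_finsupp.1 hm
  set n := c.support.sup id + 1
  have hn : ∀ α ∈ c.support, α < p ^ n := by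
    intro α hα
    have h1 : α ≤ c.support.sup id := Finset.le_sup (f := id) hα
    exact (show α < n by omega).trans (Nat.lt_pow_self (by omega))
  have hmem : (c.sum fun α r => r • W p α) ∈ Submodule.span ℂ
      (Set.range fun (β : Fin (p ^ n)) (ω : VilenkinGroup p) => starRingEnd ℂ (W p β ω)) := by
    refine Submodule.sum_mem _ fun α hα => Submodule.smul_mem _ _ (Submodule.subset_span ?_)
    obtain ⟨β, hβ, hneg⟩ := exists_h_eq_neg n α (hn α hα)
    exact ⟨⟨β, hβ⟩, funext fun ω => conj_W hneg ω⟩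
  obtain ⟨a, ha⟩ := (Submodule.mem_span_range_iff_exists_fun ℂ).1 hmem
  refine ⟨n, by omega, fun α => if hα : α < p ^ n then a ⟨α, hα⟩ else 0, fun ω => ?_⟩
  rw [← ha, Finset.sum_range]
  simp

/-- The function `m` depends only on the coordinates of index `1, …, n`. -/
def DependsOnDigits (n : ℕ) (m : VilenkinGroup p → ℂ) : Prop :=
  ∀ x y : VilenkinGroup p, (∀ j : ℤ, 1 ≤ j → j ≤ n → x.coord j = y.coord j) → m x = m y

theorem dependsOnDigits_W {n α : ℕ} (hα : α < p ^ n) : DependsOnDigits n (W p α) := by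
  intro x y hxy
  refine chi_congr_left fun j hj => ?_
  rw [coord_h] at hj
  have h1 : 1 - j ≤ 0 := by
    by_contra h1
    exact hj (if_neg h1)
  rw [if_pos h1] at hj
  refine hxy j (by omega) ?_
  by_contra hjn
  refine hj ?_
  have hlt : α < p ^ (-(1 - j)).toNat :=
    hα.trans_le (Nat.pow_le_pow_right (NeZero.pos p) (by omega))
  rw [Nat.div_eq_of_lt hlt, Nat.cast_zero]

theorem dependsOnDigits_sum {n : ℕ} {a : ℕ → ℂ} {m : VilenkinGroup p → ℂ}
    (hm : ∀ ω, m ω = ∑ α ∈ Finset.range (p ^ n), a α * starRingEnd ℂ (W p α ω)) :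
    DependsOnDigits n m := by
  intro x y hxy
  rw [hm, hm]
  refine Finset.sum_congr rfl fun α hα => ?_
  rw [dependsOnDigits_W (Finset.mem_range.1 hα) x y hxy]

omit [NeZero p] in
theorem delta_eq_single {l : ℕ} (hl : l < p) : delta p l = single 1 (l : ZMod p) := by
  refine ext_coord fun j => ?_
  rw [delta, coord_A_symm, coord_h, coord_single]
  split_ifs with h1 h2 h2
  · simp [h2]
  · have : p ≤ p ^ (-(j - 1)).toNat := Nat.le_self_pow (by omega) p
    rw [Nat.div_eq_of_lt (by omega), Nat.cast_zero]
  · omega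
  · rfl

theorem sum_single_eq_sum_delta (F : VilenkinGroup p → ℝ) (ω : VilenkinGroup p) :
    ∑ c : ZMod p, F (ω + single 1 c) = ∑ l ∈ Finset.range p, F (ω + delta p l) := by
  refine Finset.sum_bij' (fun c _ => c.val) (fun l _ => (l : ZMod p)) ?_ ?_ ?_ ?_ ?_
  · exact fun c _ => Finset.mem_range.2 (ZMod.val_lt c)
  · exact fun l _ => Finset.mem_univ _
  · exact fun c _ => ZMod.natCast_zmod_val c
  · exact fun l hl => ZMod.val_cast_of_lt (Finset.mem_range.1 hl)
  · intro c _
    rw [delta_eq_single (ZMod.val_lt c), ZMod.natCast_zmod_val]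

/-! ### The infinite product -/

section MaskProduct

variable {n : ℕ} {m : VilenkinGroup p → ℂ}

omit [NeZero p] in
theorem DependsOnDigits.continuous (hm : DependsOnDigits n m) : Continuous m :=
  continuous_of_invariant n fun x u hu => hm _ _ fun j _ hj => by
    rw [coord_add, hu j hj, add_zero]

omit [NeZero p] in
theorem DependsOnDigits.eq_one (hm : DependsOnDigits n m) (h0 : m 0 = 1) {N j : ℕ}
    (hj : n + N ≤ j) {ω : VilenkinGroup p} (hω : ω ∈ U p (-N)) : m ((A p).symm^[j + 1] ω) = 1 := by
  rw [← h0]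
  refine hm _ _ fun i _ hi => ?_
  rw [coord_A_symm_iterate, hω _ (by push_cast; omega), coord_zero]

omit [NeZero p] in
theorem multipliable_mask (hm : DependsOnDigits n m) (h0 : m 0 = 1) (ω : VilenkinGroup p) :
    Multipliable fun j : ℕ => m ((A p).symm^[j + 1] ω) := by
  obtain ⟨N, hN⟩ := exists_nat_mem_U ω
  refine multipliable_of_ne_finset_one (s := Finset.range (n + N)) fun j hj => ?_
  exact hm.eq_one h0 (by simpa using hj) (hN N le_rfl)

omit [NeZero p] in
theorem maskProduct_eq_prod (hm : DependsOnDigits n m) (h0 : m 0 = 1) {N K : ℕ} (hK : n + N ≤ K)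
    {ω : VilenkinGroup p} (hω : ω ∈ U p (-N)) :
    maskProduct m ω = ∏ j ∈ Finset.range K, m ((A p).symm^[j + 1] ω) :=
  tprod_eq_prod fun j hj => hm.eq_one h0 (hK.trans (by simpa using hj)) hω

omit [NeZero p] in
-- Replacing `ω` by `A ω` shifts the index by one and brings in the factor `m ω` at `j = 0`.
theorem maskProduct_A (hm : DependsOnDigits n m) (h0 : m 0 = 1) (ω : VilenkinGroup p) :
    maskProduct m (A p ω) = maskProduct m ω * m ω := by
  obtain ⟨N, hN⟩ := exists_nat_mem_U ω
  have hA : A p ω ∈ U p (-(N + 1 : ℕ)) := A_mem_U.2 (by simpa using hN N le_rfl)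
  rw [maskProduct_eq_prod hm h0 (le_refl (n + (N + 1))) hA,
    maskProduct_eq_prod hm h0 (le_refl (n + N)) (hN N le_rfl), ← add_assoc, Finset.prod_range_succ']
  simp

omit [NeZero p] in
theorem maskProduct_add (hm : DependsOnDigits n m) (ω : VilenkinGroup p) {u : VilenkinGroup p}
    (hu : u ∈ U p (n - 1)) : maskProduct m (ω + u) = maskProduct m ω := by
  refine tprod_congr fun j => hm _ _ fun i _ hi => ?_
  rw [coord_A_symm_iterate, coord_A_symm_iterate, coord_add, hu _ (by push_cast; omega), add_zero]

omit [NeZero p] in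
theorem continuous_maskProduct (hm : DependsOnDigits n m) : Continuous (maskProduct m) :=
  continuous_of_invariant (n - 1) fun ω _ hu => maskProduct_add hm ω hu

/-- The finite products `∏_{j=1}^N |m(A^{-j} ω)|²`. -/
noncomputable def normSqProd (m : VilenkinGroup p → ℂ) (N : ℕ) (ω : VilenkinGroup p) : ℝ :=
  ∏ j ∈ Finset.range N, ‖m ((A p).symm^[j + 1] ω)‖ ^ 2

omit [NeZero p] in
theorem normSqProd_nonneg (N : ℕ) (ω : VilenkinGroup p) : 0 ≤ normSqProd m N ω :=
  Finset.prod_nonneg fun _ _ => sq_nonneg _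

omit [NeZero p] in
theorem DependsOnDigits.continuous_normSqProd (hm : DependsOnDigits n m) (N : ℕ) :
    Continuous (normSqProd m N) :=
  continuous_finsetProd _ fun _ _ =>
    ((hm.continuous.comp (continuous_A_symm.iterate _)).norm.pow 2)

omit [NeZero p] in
-- The first `N` factors read coordinates of index at least `1 - N`. Only the next factor sees the
-- one of index `-N`, as its coordinate `1`, where `delta` acts.
theorem normSqProd_add_single (hm : DependsOnDigits n m) (N : ℕ) (ω : VilenkinGroup p)
    (c : ZMod p) : normSqProd m N (ω + single (-N) c) = normSqProd m N ω := by
  refine Finset.prod_congr rfl fun j hj => ?_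
  rw [Finset.mem_range] at hj
  rw [hm _ ((A p).symm^[j + 1] ω) fun i hi _ => ?_]
  rw [coord_A_symm_iterate, coord_A_symm_iterate, coord_add, coord_single,
    if_neg (by push_cast; omega), add_zero]

omit [NeZero p] in
theorem A_symm_iterate_add_single (N : ℕ) (ω : VilenkinGroup p) (c : ZMod p) :
    (A p).symm^[N + 1] (ω + single (-N) c) = (A p).symm^[N + 1] ω + single 1 c := by
  refine ext_coord fun i => ?_
  rw [coord_add, coord_A_symm_iterate, coord_A_symm_iterate, coord_add, coord_single, coord_single]
  congr 1
  refine if_congr ?_ rfl rfl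
  push_cast
  omega

variable (hsum : ∀ ω : VilenkinGroup p, ∑ l ∈ Finset.range p, ‖m (ω + delta p l)‖ ^ 2 ≤ 1)

include hsum

theorem sum_normSqProd_succ_le (hm : DependsOnDigits n m) (N : ℕ) (ω : VilenkinGroup p) :
    ∑ c : ZMod p, normSqProd m (N + 1) (ω + single (-N) c) ≤ normSqProd m N ω := by
  have h1 : ∀ c : ZMod p, normSqProd m (N + 1) (ω + single (-N) c) =
      normSqProd m N ω * ‖m ((A p).symm^[N + 1] ω + single 1 c)‖ ^ 2 := by
    intro c
    rw [normSqProd, Finset.prod_range_succ, ← normSqProd, normSqProd_add_single hm,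
      A_symm_iterate_add_single]
  simp only [h1, ← Finset.mul_sum]
  rw [sum_single_eq_sum_delta fun x => ‖m x‖ ^ 2]
  exact mul_le_of_le_one_right (normSqProd_nonneg N ω) (hsum _)

theorem lintegral_normSqProd_le (hm : DependsOnDigits n m) (N : ℕ) :
    ∫⁻ ω in U p (-N), ENNReal.ofReal (normSqProd m N ω) ∂haar p ≤ 1 := by
  induction N with
  | zero => simp [normSqProd, haar_U]
  | succ N ih =>
    refine le_trans ?_ ih
    rw [setLIntegral_U]
    have hN : (-((N + 1 : ℕ) : ℤ)) + 1 = -N := by push_cast; ring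
    rw [hN, ← lintegral_finsetSum]
    · refine lintegral_mono fun ω => ?_
      rw [← ENNReal.ofReal_sum_of_nonneg fun c _ => normSqProd_nonneg _ _]
      exact ENNReal.ofReal_le_ofReal (sum_normSqProd_succ_le hsum hm N ω)
    · intro c _
      exact (ENNReal.continuous_ofReal.comp ((hm.continuous_normSqProd _).comp
        (continuous_add_const _))).measurable

theorem norm_mask_le_one (ω : VilenkinGroup p) : ‖m ω‖ ≤ 1 := by
  have h1 := Finset.single_le_sum (f := fun l => ‖m (ω + delta p l)‖ ^ 2)
    (fun _ _ => sq_nonneg _) (Finset.mem_range.2 (NeZero.pos p))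
  have h0 : delta p 0 = 0 := by
    rw [delta_eq_single (NeZero.pos p)]
    exact ext_coord fun j => by simp [coord_single, coord_zero]
  have h2 := h1.trans (hsum ω)
  simp only [h0, add_zero] at h2
  exact (sq_le_one_iff₀ (norm_nonneg _)).1 h2

theorem norm_maskProduct_sq_le (hm : DependsOnDigits n m) (h0 : m 0 = 1) {N : ℕ}
    {ω : VilenkinGroup p} (hω : ω ∈ U p (-N)) :
    ‖maskProduct m ω‖ ^ 2 ≤ normSqProd m N ω := by
  -- On `U_{-N}` the product has at most `N + n` nontrivial factors; the last `n` are bounded by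
  -- `1`.
  rw [maskProduct_eq_prod hm h0 (le_of_eq (add_comm n N)) hω, Finset.prod_range_add, norm_mul,
    norm_prod, norm_prod, mul_pow, ← Finset.prod_pow, ← Finset.prod_pow]
  refine mul_le_of_le_one_right (normSqProd_nonneg N ω) ?_
  refine Finset.prod_le_one (fun _ _ => sq_nonneg _) fun j _ => ?_
  exact pow_le_one₀ (norm_nonneg _) (norm_mask_le_one hsum _)

theorem memLp_maskProduct (hm : DependsOnDigits n m) (h0 : m 0 = 1) :
    MemLp (maskProduct m) 2 (haar p) := by
  refine ⟨(continuous_maskProduct hm).aestronglyMeasurable, ?_⟩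
  rw [eLpNorm_lt_top_iff_lintegral_rpow_enorm_lt_top (by simp) (by simp)]
  refine lt_of_le_of_lt ?_ ENNReal.one_lt_top
  have hdir : Directed (· ⊆ ·) fun N : ℕ => (U p (-N) : Set (VilenkinGroup p)) :=
    Monotone.directed_le fun a b hab => U_antitone (p := p) (by omega)
  rw [← setLIntegral_univ, ← iUnion_U, setLIntegral_iUnion_of_directed _ hdir]
  refine iSup_le fun N => le_trans ?_ (lintegral_normSqProd_le hsum hm N)
  refine setLIntegral_mono' (measurableSet_U _) fun ω hω => ?_
  rw [← ofReal_norm, ENNReal.ofReal_rpow_of_nonneg (norm_nonneg _) (by simp)]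
  refine ENNReal.ofReal_le_ofReal ?_
  simpa using norm_maskProduct_sq_le hsum hm h0 hω

end MaskProduct

/-! ### The inverse Fourier transform on `L²(G)` of a function constant on cosets -/

/-- The restriction of `g` to `U_{-N}`, extended by zero. -/
noncomputable def truncate (g : VilenkinGroup p → ℂ) (N : ℕ) : VilenkinGroup p → ℂ :=
  (U p (-N) : Set (VilenkinGroup p)).indicator g

omit [NeZero p] in
theorem isTest_truncate {M : ℤ} (hM : 0 ≤ M) {g : VilenkinGroup p → ℂ}
    (hg : ∀ ω, ∀ u ∈ U p M, g (ω + u) = g ω) (N : ℕ) : IsTest (-N) M (truncate g N) where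
  supp ω hω := Set.indicator_of_notMem hω _
  inv ω u hu := by
    have hiff : ω + u ∈ U p (-N) ↔ ω ∈ U p (-N) :=
      (U p (-N)).add_mem_cancel_right (U_antitone (by omega : -(N : ℤ) ≤ M) hu)
    by_cases hω : ω ∈ U p (-N)
    · rw [truncate, Set.indicator_of_mem (hiff.2 hω), Set.indicator_of_mem hω, hg ω u hu]
    · rw [truncate, Set.indicator_of_notMem (mt hiff.1 hω), Set.indicator_of_notMem hω]

omit [NeZero p] in
theorem IsTest.sub {N N' M : ℤ} {f g : VilenkinGroup p → ℂ} (hf : IsTest N M f)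
    (hg : IsTest N' M g) : IsTest (min N N') M (f - g) where
  supp ω hω := by
    rw [Pi.sub_apply, hf.supp ω fun h => hω (U_antitone (min_le_left _ _) h),
      hg.supp ω fun h => hω (U_antitone (min_le_right _ _) h), sub_zero]
  inv ω u hu := by rw [Pi.sub_apply, Pi.sub_apply, hf.inv ω u hu, hg.inv ω u hu]

theorem tendsto_eLpNorm_truncate {g : VilenkinGroup p → ℂ} (hg : MemLp g 2 (haar p)) :
    Tendsto (fun N => eLpNorm (truncate g N - g) 2 (haar p)) atTop (𝓝 0) := by
  have hlin : Tendsto (fun N : ℕ => ∫⁻ x, ‖(truncate g N - g) x‖ₑ ^ (2 : ℝ) ∂haar p) atTop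
      (𝓝 (∫⁻ _, 0 ∂haar p)) := by
    refine tendsto_lintegral_of_dominated_convergence' (fun x => ‖g x‖ₑ ^ (2 : ℝ)) (fun N => ?_)
      (fun N => Eventually.of_forall fun x => ?_) ?_ (Eventually.of_forall fun x => ?_)
    · exact ((hg.1.indicator (measurableSet_U _)).sub hg.1).enorm.pow_const _
    · by_cases hx : x ∈ (U p (-N) : Set (VilenkinGroup p))
      · simp [truncate, Set.indicator_of_mem hx]
      · simp [truncate, Set.indicator_of_notMem hx]
    · have := lintegral_rpow_enorm_lt_top_of_eLpNorm_lt_top (by simp) (by simp) hg.2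
      simpa using this.ne
    · obtain ⟨N, hN⟩ := exists_nat_mem_U x
      refine tendsto_const_nhds.congr' ?_
      filter_upwards [eventually_ge_atTop N] with K hK
      have hx : x ∈ (U p (-K) : Set (VilenkinGroup p)) := hN K hK
      simp [truncate, Set.indicator_of_mem hx]
  have hpow := (ENNReal.continuous_rpow_const (y := 1 / 2)).continuousAt.tendsto.comp hlin
  simp only [lintegral_zero] at hpow
  rw [ENNReal.zero_rpow_of_pos (by norm_num)] at hpow
  refine hpow.congr fun N => ?_
  rw [eLpNorm_eq_lintegral_rpow_enorm_toReal (by simp) (by simp)]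
  simp

/-- The truncations converge to `g`, and by Plancherel their inverse transforms have the same mutual
distances. -/
theorem exists_limit_fourierInv_truncate {M : ℤ} (hM : 0 ≤ M) {g : VilenkinGroup p → ℂ}
    (hg : ∀ ω, ∀ u ∈ U p M, g (ω + u) = g ω) (hg2 : MemLp g 2 (haar p)) :
    ∃ φ, MemLp φ 2 (haar p) ∧
      Tendsto (fun N => eLpNorm (fourierInv (truncate g N) - φ) 2 (haar p)) atTop (𝓝 0) := by
  have htest := isTest_truncate hM hg
  have hf := fun N => (htest N).fourierInv.memLp 2
  have ht := fun N => (htest N).memLp 2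
  have hcauchy : CauchySeq fun N => (ht N).toLp :=
    ((Lp.tendsto_Lp_iff_tendsto_eLpNorm'' _ ht g hg2).2 (tendsto_eLpNorm_truncate hg2)).cauchySeq
  have hedist : ∀ N K, edist (hf N).toLp (hf K).toLp = edist (ht N).toLp (ht K).toLp := by
    intro N K
    rw [Lp.edist_toLp_toLp, Lp.edist_toLp_toLp,
      ← fourierInv_sub (htest N).integrable (htest K).integrable,
      ((htest N).sub (htest K)).eLpNorm_fourierInv]
  have hcauchy' : CauchySeq fun N => (hf N).toLp := by
    rw [EMetric.cauchySeq_iff] at hcauchy ⊢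
    simpa only [hedist] using hcauchy
  obtain ⟨φ, hφ⟩ := cauchySeq_tendsto_of_complete hcauchy'
  refine ⟨φ, Lp.memLp φ, ?_⟩
  rw [← Lp.toLp_coeFn φ (Lp.memLp φ)] at hφ
  exact (Lp.tendsto_Lp_iff_tendsto_eLpNorm'' _ hf φ (Lp.memLp φ)).1 hφ

theorem exists_subseq_tendsto_ae {f : ℕ → VilenkinGroup p → ℂ} {φ : VilenkinGroup p → ℂ}
    (hf : ∀ N, MemLp (f N) 2 (haar p)) (hφ : MemLp φ 2 (haar p))
    (hlim : Tendsto (fun N => eLpNorm (f N - φ) 2 (haar p)) atTop (𝓝 0)) :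
    ∃ ns : ℕ → ℕ, StrictMono ns ∧
      ∀ᵐ x ∂haar p, Tendsto (fun k => f (ns k) x) atTop (𝓝 (φ x)) :=
  (tendstoInMeasure_of_tendsto_eLpNorm (by simp) (fun N => (hf N).1) hφ.1
    hlim).exists_seq_tendsto_ae

theorem quasiMeasurePreserving_A_sub (a : VilenkinGroup p) :
    Measure.QuasiMeasurePreserving (fun x => A p x - a) (haar p) (haar p) := by
  have hA : Measure.QuasiMeasurePreserving (A p) (haar p) (haar p) :=
    ⟨continuous_A.measurable, by rw [map_A_haar]; exact Measure.smul_absolutelyContinuous⟩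
  exact (measurePreserving_sub_right (haar p) a).quasiMeasurePreserving.comp hA

/-! ### The refinement equation -/

/-- Substitute `A ω` for the variable: this yields the factor `p`, and `A` moves to the other
argument of `chi`. Each conjugate `W_α` becomes a translation by `h p α`. The identity is exact
because `A` maps `U_{-N}` onto `U_{-N-1}`. -/
theorem fourierInv_truncate_maskProduct_succ {n : ℕ} {a : ℕ → ℂ} {m : VilenkinGroup p → ℂ}
    (hm : ∀ ω, m ω = ∑ α ∈ Finset.range (p ^ n), a α * starRingEnd ℂ (W p α ω))
    (hA : ∀ ω, maskProduct m (A p ω) = maskProduct m ω * m ω) (N : ℕ)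
    (hint : Integrable (truncate (maskProduct m) N) (haar p)) (x : VilenkinGroup p) :
    fourierInv (truncate (maskProduct m) (N + 1)) x = p * ∑ α ∈ Finset.range (p ^ n),
      a α * fourierInv (truncate (maskProduct m) N) (A p x - h p α) := by
  have htr : ∀ ω, truncate (maskProduct m) (N + 1) (A p ω) =
      truncate (maskProduct m) N ω * m ω := by
    intro ω
    have hiff : A p ω ∈ U p (-(N + 1 : ℕ)) ↔ ω ∈ U p (-N) := by
      rw [A_mem_U]
      simp
    by_cases hω : ω ∈ U p (-N)
    · rw [truncate, truncate, Set.indicator_of_mem (hiff.2 hω), Set.indicator_of_mem hω, hA]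
    · rw [truncate, truncate, Set.indicator_of_notMem (mt hiff.1 hω), Set.indicator_of_notMem hω,
        zero_mul]
  rw [fourierInv, ← integral_comp_A]
  congr 1
  simp only [fourierInv, ← integral_const_mul]
  rw [← integral_finsetSum _ fun α _ => (integrable_mul_chi hint _).const_mul _]
  refine integral_congr_ae (Eventually.of_forall fun ω => ?_)
  simp only [htr, hm, ← chi_A, Finset.mul_sum, Finset.sum_mul]
  refine Finset.sum_congr rfl fun α _ => ?_
  rw [sub_eq_add_neg, chi_add_left, W, conj_chi_right, chi_comm ω]
  ring

end VilenkinGroup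

/-! ### Construction of the refinable function -/

open MeasureTheory Filter Topology VilenkinGroup in
theorem mainTheorem4 {p : ℕ} [NeZero p] (hp : 2 ≤ p) (m₀ : VilenkinGroup p → ℂ)
    (hWalsh : VilenkinGroup.IsWalshPolynomial m₀) (hzero : m₀ 0 = 1)
    (hsum : ∀ ω : VilenkinGroup p,
      ∑ l ∈ Finset.range p, ‖m₀ (ω + VilenkinGroup.delta p l)‖ ^ 2 ≤ 1) :
    (∀ ω : VilenkinGroup p, Multipliable fun j : ℕ => m₀ ((VilenkinGroup.A p).symm^[j + 1] ω)) ∧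
    MeasureTheory.MemLp (VilenkinGroup.maskProduct m₀) 2 (VilenkinGroup.haar p) ∧
    ∃ φ : VilenkinGroup p → ℂ,
      VilenkinGroup.IsFourierL2 φ (VilenkinGroup.maskProduct m₀) ∧
      (∀ ψ : VilenkinGroup p → ℂ, VilenkinGroup.IsFourierL2 ψ (VilenkinGroup.maskProduct m₀) →
        ψ =ᵐ[VilenkinGroup.haar p] φ) ∧
      VilenkinGroup.IsCompactlySupported φ ∧
      VilenkinGroup.IsRefinableWithMask φ m₀ := by
  obtain ⟨n, hn, a, ha⟩ := hWalsh.exists_eq_sum hp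
  have hm := dependsOnDigits_sum ha
  have hg2 := memLp_maskProduct hsum hm hzero
  -- With `n ≥ 1` the period group `U_{n-1}` lies in every `U_{-N}`, so truncation preserves the
  -- periods of `g`.
  have hM : (0 : ℤ) ≤ n - 1 := by omega
  have htest := isTest_truncate hM fun ω u hu => maskProduct_add hm ω hu
  obtain ⟨φ, hφ, hlim⟩ :=
    exists_limit_fourierInv_truncate hM (fun ω u hu => maskProduct_add hm ω hu) hg2
  have hφF : IsFourierL2 φ (maskProduct m₀) := by
    refine ⟨hφ, hg2, fun N => fourierInv (truncate (maskProduct m₀) N),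
      fun N => ⟨(htest N).fourierInv.memLp 1, (htest N).fourierInv.memLp 2⟩, hlim, ?_⟩
    simpa only [(htest _).fourierL1_fourierInv] using tendsto_eLpNorm_truncate hg2
  have hmem := fun N => (htest N).fourierInv.memLp 2
  obtain ⟨ns, hns, hae⟩ := exists_subseq_tendsto_ae hmem hφ hlim
  refine ⟨multipliable_mask hm hzero, hg2, φ, hφF, fun ψ hψ => hψ.ae_eq hφF,
    ⟨U p (-(n - 1)), isCompact_U_int _, ?_⟩, hφ, n, hn, a, ?_, ha⟩
  · filter_upwards [hae] with x hx hxU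
    refine tendsto_nhds_unique hx (tendsto_const_nhds.congr fun k => ?_)
    exact ((htest (ns k)).fourierInv.supp x hxU).symm
  -- A further subsequence makes the terms of index `ns (ms k) + 1` converge as well, so both sides
  -- of the refinement identity have limits.
  · obtain ⟨ms, hms, hae'⟩ := exists_subseq_tendsto_ae (fun k => hmem (ns k + 1)) hφ
      (hlim.comp ((tendsto_add_atTop_nat 1).comp hns.tendsto_atTop))
    have hall : ∀ᵐ x ∂haar p, ∀ α, Tendsto (fun k =>
        fourierInv (truncate (maskProduct m₀) (ns k)) (A p x - h p α)) atTop
        (𝓝 (φ (A p x - h p α))) :=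
      -- Null sets pull back to null sets under `x ↦ A x - h p α`.
      ae_all_iff.2 fun α => (quasiMeasurePreserving_A_sub (h p α)).ae
        (p := fun y => Tendsto (fun k => fourierInv (truncate (maskProduct m₀) (ns k)) y) atTop
          (𝓝 (φ y))) hae
    filter_upwards [hall, hae'] with x hx hx'
    refine tendsto_nhds_unique hx' ?_
    have hstep : ∀ k, fourierInv (truncate (maskProduct m₀) (ns (ms k) + 1)) x =
        p * ∑ α ∈ Finset.range (p ^ n),
          a α * fourierInv (truncate (maskProduct m₀) (ns (ms k))) (A p x - h p α) := fun k =>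
      fourierInv_truncate_maskProduct_succ ha (maskProduct_A hm hzero) _ (htest _).integrable x
    simp only [hstep]
    exact (tendsto_finsetSum _ fun α _ =>
      ((hx α).comp hms.tendsto_atTop).const_mul (a α)).const_mul (p : ℂ)
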